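/- Definitions. Let $\mathbb{K}=\mathbb{R}$ or $\mathbb{C}$. An analytic function $f$ on an open set $U\subset\mathbb{K}$, with values in $\mathbb{K}$, is called *differentially algebraic* (DA) on $U$ if there are an integer $n\ge 0$ and a nonzero polynomial $Q$ in $n+2$ variables with coefficients in $\mathbb{K}$ such that $$Q(z,f(z),f'(z),\dots,f^{(n)}(z))=0\qquad\text{for all } z\in U.$$ A subset $V$ of an open set $U\subset\mathbb{R}^N$ is called *generic* in $U$ if $U\setminus V$ is both of Lebesgue measure zero and of first Baire category. Lemma (Alternative Lemma). Let $\mathbb{K}=\mathbb{R}$ or $\mathbb{C}$, let $p\ge 0$, let $\Omega\subset\mathbb{R}^p\times\mathbb{K}$ be a nonempty connected open set, and let $F:\Omega\to\mathbb{K}$ be analytic, that is, $F$ is jointly real-analytic on $\Omega$ and for each $u$ the function $F(u,\cdot)$ is analytic over $\mathbb{K}$ (holomorphic if $\mathbb{K}=\mathbb{C}$). For $u\in\mathbb{R}^p$ put $$\Omega(u)=\{v\in\mathbb{K} : (u,v)\in\Omega\},\qquad \Omega'=\{u\in\mathbb{R}^p : \Omega(u)\ne\emptyset\}.$$ Then exactly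 one of the following two alternatives holds: (I) For every $u\in\Omega'$, $F(u,\cdot)$ is DA on $\Omega(u)$; in fact all these functions satisfy the same differential equation: there are an integer $n\ge 0$ and a nonzero polynomial $Q$ in $n+2$ variables with coefficients in $\mathbb{K}$ such that $$Q\bigl(v,F(u,v),\partial_vF(u,v),\dots,\partial_v^{\,n}F(u,v)\bigr)=0\qquad\text{for all } (u,v)\in\Omega.$$ (II) For generic $u\in\Omega'$, $F(u,\cdot)$ is not DA on $\Omega(u)$; that is, the set of $u\in\Omega'$ for which $F(u,\cdot)$ is DA on $\Omega(u)$ is of Lebesgue measure zero and of first Baire category. -/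

import Mathlib

namespace DiffAlg

/-- `f` satisfies the algebraic differential equation
`Q(z, f(z), f'(z), …, f⁽ⁿ⁾(z)) = 0` at every point `z` of `U`.
Variable `0` of `Q` stands for `z`, and variable `k + 1` for the `k`-th derivative of `f`. -/
def SatisfiesADE {𝕂 : Type*} [RCLike 𝕂] {n : ℕ} (Q : MvPolynomial (Fin (n + 2)) 𝕂)
    (f : 𝕂 → 𝕂) (U : Set 𝕂) : Prop :=
  ∀ z ∈ U, MvPolynomial.eval
    (Fin.cons z (fun k : Fin (n + 1) => iteratedDeriv (k : ℕ) f z) : Fin (n + 2) → 𝕂) Q = 0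

/-- `f` is a differentially algebraic (DA) function on the open set `U`: it is analytic there and
satisfies, throughout `U`, some algebraic differential equation given by a nonzero polynomial. -/
def IsDA {𝕂 : Type*} [RCLike 𝕂] (f : 𝕂 → 𝕂) (U : Set 𝕂) : Prop :=
  AnalyticOnNhd 𝕂 f U ∧
    ∃ (n : ℕ) (Q : MvPolynomial (Fin (n + 2)) 𝕂), Q ≠ 0 ∧ SatisfiesADE Q f U

/-- `V` is generic in the open set `U ⊆ ℝᴺ`: `V ⊆ U`, and the complement of `V` in `U` is both of
Lebesgue measure zero and of first Baire category. -/
def IsGenericIn {N : ℕ} (V U : Set (EuclideanSpace ℝ (Fin N))) : Prop :=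
  V ⊆ U ∧ MeasureTheory.volume (U \ V) = 0 ∧ IsMeagre (U \ V)

/-- The slice `Ω(u) = {v | (u, v) ∈ Ω}`. -/
def slice {α β : Type*} (Ω : Set (α × β)) (u : α) : Set β :=
  {v | (u, v) ∈ Ω}

/-- The set `Ω'` of all `u` for which the slice `Ω(u)` is nonempty. -/
def base {α β : Type*} (Ω : Set (α × β)) : Set α :=
  {u | (slice Ω u).Nonempty}

end DiffAlg

/-! Countably many equations suffice to detect all DA functions. For a finite set `S` of
differential monomials, let `P S` be a determinant whose rows are total derivatives, of suitable
orders, of the monomials in `S`. If `f` solves a nonzero equation supported in `S`, its coefficients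
form a kernel vector of the matrix along the jet of `f`, so `P S` vanishes there
(`exists_universal_polynomial`). `P S` itself is nonzero because some polynomial satisfies no
nontrivial equation supported in `S` (`exists_polynomial_no_relation`). Substituting the jet of
`F(u, ·)` in `P S` gives an analytic function on `Ω`. If it vanishes identically for some `S`,
alternative (I) holds. Otherwise, for each `S`, it vanishes on a whole slice only for a null meagre
set of `u` (`null_and_isMeagre_vanishing_slices`); the union over the countably many `S` gives (II).
-/

namespace DiffAlg

/-! ### Differential polynomials and elimination of constants -/

section Algebra

variable {K : Type*} [Field K]

/-- The total derivative on polynomials in `z, f, f', …`: variable `0` is `z`, and variable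
`k + 1` is the `k`-th derivative of the unknown function. -/
noncomputable def totalDeriv (K : Type*) [Field K] :
    Derivation K (MvPolynomial ℕ K) (MvPolynomial ℕ K) :=
  MvPolynomial.mkDerivation K fun i => Nat.casesOn i 1 fun k => MvPolynomial.X (k + 2)

theorem totalDeriv_X_zero : totalDeriv K (MvPolynomial.X 0) = 1 :=
  MvPolynomial.mkDerivation_X _ _ _

theorem totalDeriv_X_succ (k : ℕ) :
    totalDeriv K (MvPolynomial.X (k + 1)) = MvPolynomial.X (k + 2) :=
  MvPolynomial.mkDerivation_X _ _ _

open Polynomial in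
/-- Substitution of a polynomial `f` and its derivatives in a differential polynomial. -/
noncomputable def substPoly (f : K[X]) : MvPolynomial ℕ K →ₐ[K] K[X] :=
  MvPolynomial.aeval fun i => Nat.casesOn i X fun k => derivative^[k] f

open Polynomial in
theorem substPoly_totalDeriv (f : K[X]) (Q : MvPolynomial ℕ K) :
    substPoly f (totalDeriv K Q) = derivative (substPoly f Q) := by
  induction Q using MvPolynomial.induction_on with
  | C a =>
    have h : totalDeriv K (MvPolynomial.C a) = 0 := MvPolynomial.derivation_C _ _
    rw [h, map_zero, substPoly, MvPolynomial.aeval_C]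
    exact derivative_C.symm
  | add p q hp hq => simp only [map_add, hp, hq]
  | mul_X p i hp =>
    have hX : substPoly f (totalDeriv K (MvPolynomial.X i)) =
        derivative (substPoly f (MvPolynomial.X i)) := by
      cases i with
      | zero => simp [totalDeriv_X_zero, substPoly]
      | succ k =>
        rw [totalDeriv_X_succ]
        simp [substPoly, Function.iterate_succ_apply']
    rw [Derivation.leibniz, map_mul, derivative_mul, ← hX, ← hp]
    simp only [map_add, smul_eq_mul, map_mul]
    ring

open Polynomial in
theorem substPoly_iterate_totalDeriv (f : K[X]) (Q : MvPolynomial ℕ K) (k : ℕ) :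
    substPoly f ((totalDeriv K)^[k] Q) = derivative^[k] (substPoly f Q) := by
  induction k with
  | zero => rfl
  | succ k ih => rw [Function.iterate_succ_apply', Function.iterate_succ_apply',
      substPoly_totalDeriv, ih]

theorem iterate_totalDeriv_sum {ι : Type*} (s : Finset ι) (c : ι → K) (M : ι → MvPolynomial ℕ K)
    (k : ℕ) : (totalDeriv K)^[k] (∑ i ∈ s, c i • M i) =
      ∑ i ∈ s, c i • (totalDeriv K)^[k] (M i) := by
  induction k with
  | zero => rfl
  | succ k ih => simp only [Function.iterate_succ_apply', ih, map_sum, Derivation.map_smul]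

open Polynomial in
theorem eval_iterate_derivative_eq_taylor_coeff (f : K[X]) (x : K) (k : ℕ) :
    (derivative^[k] f).eval x = (k.factorial : K) * (taylor x f).coeff k := by
  rw [taylor_coeff, ← factorial_smul_hasseDeriv]
  simp

open Polynomial in
/-- Hermite interpolation: the derivatives of order `< n` of a polynomial can be prescribed at
finitely many points. -/
theorem exists_polynomial_derivatives_eq [CharZero K] (t : Finset K) (y : K → ℕ → K) (n : ℕ) :
    ∃ f : K[X], ∀ x ∈ t, ∀ k < n, (derivative^[k] f).eval x = y x k := by
  have hco : Pairwise (Function.onFun IsCoprime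
      fun x : K => Ideal.span {(X - C x : K[X]) ^ n}) := by
    intro a b hab
    rw [Function.onFun, Ideal.isCoprime_span_singleton_iff]
    exact (pairwise_coprime_X_sub_C (s := id) Function.injective_id hab).pow
  obtain ⟨f, hf⟩ := Ideal.exists_forall_sub_mem_ideal
    (I := fun x : t => Ideal.span {(X - C (x : K) : K[X]) ^ n})
    (fun a b hab => hco (Subtype.coe_injective.ne hab))
    -- Chinese remainder theorem: modulo `(X - x)^n`, prescribe the Taylor polynomial at `x`,
    -- re-expanded in powers of `X - x`.
    (fun x : t => taylor (-(x : K))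
      (∑ k ∈ Finset.range n, C (y x k / (k.factorial : K)) * X ^ k))
  refine ⟨f, fun x hx k hk => ?_⟩
  have h := hf ⟨x, hx⟩
  rw [Ideal.mem_span_singleton] at h
  have h2 := pow_sub_dvd_iterate_derivative_of_pow_dvd k h
  have h3 : (derivative^[k] (f - taylor (-x)
      (∑ k ∈ Finset.range n, C (y x k / (k.factorial : K)) * X ^ k))).eval x = 0 := by
    have : (X - C x : K[X]) ∣ _ := (dvd_pow_self _ (Nat.sub_ne_zero_of_lt hk)).trans h2
    exact dvd_iff_isRoot.1 this
  rw [iterate_derivative_sub, eval_sub, sub_eq_zero] at h3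
  rw [h3, eval_iterate_derivative_eq_taylor_coeff, taylor_taylor, add_neg_cancel, taylor_zero]
  have hk0 : (k.factorial : K) ≠ 0 := Nat.cast_ne_zero.2 k.factorial_ne_zero
  simp [coeff_C_mul, coeff_X_pow, hk]
  field_simp

/-- A finite-dimensional space of polynomials is separated by finitely many points with pairwise
distinct `0`-th coordinates. -/
theorem exists_separating_points [CharZero K] (W : Submodule K (MvPolynomial ℕ K))
    [FiniteDimensional K W] (B : Finset K) :
    ∃ (t : Finset K) (y : K → ℕ → K), Disjoint t B ∧ (∀ x ∈ t, y x 0 = x) ∧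
      ∀ Q ∈ W, (∀ x ∈ t, MvPolynomial.eval (y x) Q = 0) → Q = 0 := by
  classical
  induction hn : Module.finrank K W using Nat.strong_induction_on generalizing W B with
  | _ n ih =>
  by_cases hW : W = ⊥
  · subst hW
    exact ⟨∅, fun _ _ => 0, by simp, by simp, fun Q hQ _ => by simpa using hQ⟩
  obtain ⟨Q₀, hQ₀, hne⟩ := W.ne_bot_iff.1 hW
  have hprod : (∏ b ∈ B, (MvPolynomial.X 0 - MvPolynomial.C b : MvPolynomial ℕ K)) ≠ 0 := by
    refine Finset.prod_ne_zero_iff.2 fun b _ h => ?_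
    have := congrArg (MvPolynomial.eval fun _ => b + 1) h
    simp at this
  -- The extra product keeps the new 0-th coordinate outside `B`; imposing vanishing at `p` removes
  -- `Q₀`, so the dimension drops.
  obtain ⟨p, hp⟩ : ∃ p : ℕ → K, MvPolynomial.eval p
      (Q₀ * ∏ b ∈ B, (MvPolynomial.X 0 - MvPolynomial.C b)) ≠ 0 := by
    by_contra! h
    exact mul_ne_zero hne hprod (MvPolynomial.funext fun x => by rw [h x, map_zero])
  rw [map_mul, mul_ne_zero_iff, map_prod, Finset.prod_ne_zero_iff] at hp
  have hpB : p 0 ∉ B := fun h => hp.2 _ h (by simp)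
  let W' : Submodule K (MvPolynomial ℕ K) := W ⊓ LinearMap.ker (MvPolynomial.aeval p).toLinearMap
  have hlt : W' < W := by
    refine lt_of_le_of_ne inf_le_left fun h => hp.1 ?_
    have : Q₀ ∈ W' := h ▸ hQ₀
    simpa [MvPolynomial.aeval_eq_eval] using this.2
  have : FiniteDimensional K W' := Submodule.finiteDimensional_of_le hlt.le
  obtain ⟨t, y, htB, hy, hsep⟩ := ih _ (hn ▸ Submodule.finrank_lt_finrank_of_lt hlt) W'
    (insert (p 0) B) rfl
  have hpt : p 0 ∉ t := fun h => Finset.disjoint_left.1 htB h (Finset.mem_insert_self _ _)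
  refine ⟨insert (p 0) t, Function.update y (p 0) p, ?_, ?_, ?_⟩
  · exact Finset.disjoint_insert_left.2
      ⟨hpB, htB.mono_right (Finset.subset_insert _ _)⟩
  · intro x hx
    rcases Finset.mem_insert.1 hx with rfl | hx
    · simp
    · rw [Function.update_of_ne (ne_of_mem_of_not_mem hx hpt), hy x hx]
  · intro Q hQ h
    have h0 := h (p 0) (Finset.mem_insert_self _ _)
    rw [Function.update_self] at h0
    refine hsep Q ⟨hQ, by simpa [MvPolynomial.aeval_eq_eval] using h0⟩ fun x hx => ?_
    have := h x (Finset.mem_insert_of_mem hx)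
    rwa [Function.update_of_ne (ne_of_mem_of_not_mem hx hpt)] at this

open Polynomial in
theorem eval_substPoly (f : K[X]) (Q : MvPolynomial ℕ K) (x : K) :
    (substPoly f Q).eval x = MvPolynomial.eval
      (fun i => Nat.casesOn i x fun k => (derivative^[k] f).eval x) Q := by
  have h : (Polynomial.aeval x).comp (substPoly f) = MvPolynomial.aeval
      (fun i => Nat.casesOn i x fun k => (derivative^[k] f).eval x) := by
    refine MvPolynomial.algHom_ext fun i => ?_
    cases i <;> simp [substPoly]
  have := DFunLike.congr_fun h Q
  simpa [MvPolynomial.aeval_eq_eval, Polynomial.aeval_def, Polynomial.eval₂_eq_eval_map] using this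

open Polynomial in
/-- Some polynomial function satisfies no nontrivial differential equation whose monomials belong
to a given finite set. -/
theorem exists_polynomial_no_relation [CharZero K] (S : Finset (ℕ →₀ ℕ)) :
    ∃ f : K[X], ∀ Q : MvPolynomial ℕ K, Q.support ⊆ S → substPoly f Q = 0 → Q = 0 := by
  classical
  have : Module.Finite K (MvPolynomial.restrictSupport K (S : Set (ℕ →₀ ℕ))) :=
    Module.Finite.of_basis (MvPolynomial.basisRestrictSupport K (S : Set (ℕ →₀ ℕ)))
  obtain ⟨t, y, -, hy, hsep⟩ := exists_separating_points
    (MvPolynomial.restrictSupport K (S : Set (ℕ →₀ ℕ))) ∅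
  -- Only variables below `n` occur, so a Hermite interpolant can realise every separating point as
  -- a jet.
  obtain ⟨n, hn⟩ : ∃ n : ℕ, ∀ s ∈ S, ∀ i ∈ s.support, i < n := by
    obtain ⟨n, hn⟩ := (S.biUnion Finsupp.support).exists_nat_subset_range
    exact ⟨n, fun s hs i hi => Finset.mem_range.1 (hn (Finset.mem_biUnion.2 ⟨s, hs, hi⟩))⟩
  obtain ⟨f, hf⟩ := exists_polynomial_derivatives_eq t (fun x k => y x (k + 1)) n
  refine ⟨f, fun Q hQ h0 => hsep Q ?_ fun x hx => ?_⟩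
  · rw [MvPolynomial.mem_restrictSupport_iff]
    exact_mod_cast hQ
  · rw [← (eval_zero : (0 : K[X]).eval x = 0), ← h0, eval_substPoly]
    rw [MvPolynomial.eval_eq, MvPolynomial.eval_eq]
    refine Finset.sum_congr rfl fun s hs => ?_
    congr 1
    refine Finset.prod_congr rfl fun i his => ?_
    congr 1
    have hin : i < n := hn s (hQ hs) i his
    cases i with
    | zero => exact hy x hx
    | succ k => exact (hf x hx k (by omega)).symm

/-- A spanning family of rows contains a basis. The indices chosen become orders of differentiation,
which need not be consecutive. -/
theorem exists_det_ne_zero_of_span_eq_top {ι : Type*} [Fintype ι] [DecidableEq ι] (r : ℕ → ι → K)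
    (h : Submodule.span K (Set.range r) = ⊤) :
    ∃ a : ι → ℕ, (Matrix.of fun i => r (a i)).det ≠ 0 := by
  obtain ⟨κ, a, -, hspan, hli⟩ := exists_linearIndependent' K r
  let b := Module.Basis.mk hli (by rw [hspan, h])
  let e : ι ≃ κ := (Pi.basisFun K ι).indexEquiv b
  refine ⟨a ∘ e, ?_⟩
  have hli' : LinearIndependent K (Matrix.of fun i => r ((a ∘ e) i)).row :=
    hli.comp e e.injective
  rw [Matrix.linearIndependent_rows_iff_isUnit, Matrix.isUnit_iff_isUnit_det] at hli'
  exact hli'.ne_zero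

/-- Elimination of constants: a nonzero differential polynomial vanishes on all solutions
of all nontrivial differential equations whose monomials belong to a given finite set. -/
theorem exists_universal_polynomial [CharZero K] (S : Finset (ℕ →₀ ℕ)) :
    ∃ P : MvPolynomial ℕ K, P ≠ 0 ∧
      ∀ (φ : MvPolynomial ℕ K →ₐ[K] K) (Q : MvPolynomial ℕ K), Q ≠ 0 → Q.support ⊆ S →
        (∀ k : ℕ, φ ((totalDeriv K)^[k] Q) = 0) → φ P = 0 := by
  classical
  obtain ⟨f, hf⟩ := exists_polynomial_no_relation (K := K) S
  let M : S → MvPolynomial ℕ K := fun i => MvPolynomial.monomial (i : ℕ →₀ ℕ) 1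
  let ψ : MvPolynomial ℕ K →ₐ[K] K := (Polynomial.aeval 0).comp (substPoly f)
  have hspan : Submodule.span K (Set.range fun (k : ℕ) (i : S) =>
      ψ ((totalDeriv K)^[k] (M i))) = ⊤ := by
    -- A functional killing all rows gives a relation among the monomials whose value on `f` has all
    -- derivatives zero at 0, hence is the zero polynomial.
    by_contra hne
    obtain ⟨g, hg, hg0⟩ := Submodule.exists_le_ker_of_lt_top _ (lt_top_iff_ne_top.2 hne)
    let c : S → K := fun i => g (Pi.single i 1)
    have hgc : ∀ v : S → K, g v = ∑ i, c i * v i := fun v => by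
      rw [LinearMap.pi_apply_eq_sum_univ g v]
      refine Finset.sum_congr rfl fun i _ => ?_
      rw [smul_eq_mul, mul_comm]
      congr 2
      ext j
      simp [Pi.single_apply, eq_comm]
    have hQk : ∀ k : ℕ, ψ ((totalDeriv K)^[k] (∑ i, c i • M i)) = 0 := fun k => by
      have := hg0 (Submodule.subset_span ⟨k, rfl⟩)
      rw [LinearMap.mem_ker, hgc] at this
      rw [iterate_totalDeriv_sum, map_sum]
      simpa using this
    have hsub : substPoly f (∑ i, c i • M i) = 0 := by
      ext k
      have := hQk k
      simp only [ψ, AlgHom.comp_apply, substPoly_iterate_totalDeriv] at this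
      rw [Polynomial.coe_aeval_eq_eval, eval_iterate_derivative_eq_taylor_coeff,
        Polynomial.taylor_zero, mul_eq_zero] at this
      simpa [Nat.factorial_ne_zero] using this
    have hcoeff : ∀ j : S, (∑ i, c i • M i).coeff (j : ℕ →₀ ℕ) = c j := fun j => by
      simp [M, MvPolynomial.coeff_sum, MvPolynomial.coeff_monomial]
    have hzero := hf (∑ i, c i • M i) (fun s hs => by
      by_contra hsS
      refine MvPolynomial.mem_support_iff.1 hs ?_
      rw [MvPolynomial.coeff_sum]
      refine Finset.sum_eq_zero fun i _ => ?_
      have : (i : ℕ →₀ ℕ) ≠ s := fun h => hsS (h ▸ i.2)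
      simp [M, MvPolynomial.coeff_monomial, this]) hsub
    refine hg (LinearMap.ext fun v => ?_)
    rw [hgc, LinearMap.zero_apply]
    exact Finset.sum_eq_zero fun i _ => by rw [← hcoeff i, hzero]; simp
  obtain ⟨a, ha⟩ := exists_det_ne_zero_of_span_eq_top _ hspan
  have hmap : ∀ φ : MvPolynomial ℕ K →ₐ[K] K,
      φ (Matrix.of fun j i : S => (totalDeriv K)^[a j] (M i)).det =
        (Matrix.of fun j i : S => φ ((totalDeriv K)^[a j] (M i))).det := fun φ => by
    rw [AlgHom.map_det]
    rfl
  refine ⟨(Matrix.of fun j i : S => (totalDeriv K)^[a j] (M i)).det, fun h => ha ?_, ?_⟩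
  · rw [← hmap ψ, h, map_zero]
  · intro φ Q hQ hQS hφ
    rw [hmap, ← Matrix.exists_mulVec_eq_zero_iff]
    have hQsum : Q = ∑ i : S, Q.coeff (i : ℕ →₀ ℕ) • M i := by
      conv_lhs => rw [Q.as_sum, Finset.sum_subset hQS fun s _ hs => by
        rw [MvPolynomial.notMem_support_iff.1 hs, map_zero]]
      rw [← Finset.sum_coe_sort]
      exact Finset.sum_congr rfl fun i _ => by simp [M, MvPolynomial.smul_monomial]
    refine ⟨fun i => Q.coeff (i : ℕ →₀ ℕ), fun h => hQ ?_, ?_⟩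
    · rw [hQsum]
      exact Finset.sum_eq_zero fun i _ => by
        rw [show Q.coeff (i : ℕ →₀ ℕ) = 0 from congrFun h i, zero_smul]
    · ext j
      have := hφ (a j)
      rw [hQsum, iterate_totalDeriv_sum, map_sum] at this
      simpa [Matrix.mulVec, dotProduct, mul_comm] using this

end Algebra

end DiffAlg

namespace DiffAlg

/-! ### Jets of analytic functions and joint analyticity -/

section Jets

variable {𝕂 : Type*} [RCLike 𝕂]

/-- The sequence `z, f(z), f'(z), f''(z), …`. -/
noncomputable def jet (f : 𝕂 → 𝕂) (z : 𝕂) : ℕ → 𝕂 :=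
  fun i => Nat.casesOn i z fun k => iteratedDeriv k f z

theorem satisfiesADE_iff {n : ℕ} (Q : MvPolynomial (Fin (n + 2)) 𝕂) (f : 𝕂 → 𝕂) (U : Set 𝕂) :
    SatisfiesADE Q f U ↔
      ∀ z ∈ U, MvPolynomial.eval (jet f z) (MvPolynomial.rename Fin.val Q) = 0 := by
  refine forall₂_congr fun z _ => ?_
  rw [MvPolynomial.eval_rename]
  have : (Fin.cons z (fun k : Fin (n + 1) => iteratedDeriv (k : ℕ) f z) : Fin (n + 2) → 𝕂) =
      jet f z ∘ Fin.val := by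
    ext i
    refine Fin.cases ?_ (fun k => ?_) i <;> simp [jet]
  rw [this]

theorem exists_rename_fin_val (P : MvPolynomial ℕ 𝕂) :
    ∃ (n : ℕ) (Q : MvPolynomial (Fin (n + 2)) 𝕂), MvPolynomial.rename Fin.val Q = P := by
  obtain ⟨s, q, rfl⟩ := MvPolynomial.exists_finset_rename P
  obtain ⟨n, hn⟩ := s.exists_nat_subset_range
  refine ⟨n, MvPolynomial.rename (fun i : {x // x ∈ s} =>
    (⟨i, (Finset.mem_range.1 (hn i.2)).trans (by omega)⟩ : Fin (n + 2))) q, ?_⟩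
  rw [MvPolynomial.rename_rename]
  rfl

theorem analyticOnNhd_iteratedDeriv {f : 𝕂 → 𝕂} {U : Set 𝕂} (hf : AnalyticOnNhd 𝕂 f U) (k : ℕ) :
    AnalyticOnNhd 𝕂 (iteratedDeriv k f) U := by
  rw [iteratedDeriv_eq_iterate]
  exact hf.iterated_deriv k

theorem hasDerivAt_eval_jet {f : 𝕂 → 𝕂} {z : 𝕂} (hf : AnalyticAt 𝕂 f z)
    (Q : MvPolynomial ℕ 𝕂) :
    HasDerivAt (fun w => MvPolynomial.eval (jet f w) Q)
      (MvPolynomial.eval (jet f z) (totalDeriv 𝕂 Q)) z := by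
  induction Q using MvPolynomial.induction_on with
  | C a =>
    have h : totalDeriv 𝕂 (MvPolynomial.C a) = 0 := MvPolynomial.derivation_C _ _
    simpa [h] using hasDerivAt_const z a
  | add p q hp hq => simpa only [map_add] using! hp.add hq
  | mul_X p i hp =>
    have hX : HasDerivAt (fun w => MvPolynomial.eval (jet f w) (MvPolynomial.X i))
        (MvPolynomial.eval (jet f z) (totalDeriv 𝕂 (MvPolynomial.X i))) z := by
      cases i with
      | zero => simpa [totalDeriv_X_zero, jet] using! hasDerivAt_id' z
      | succ k =>
        rw [totalDeriv_X_succ]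
        have hk : AnalyticOnNhd 𝕂 f {z} := fun w hw => Set.mem_singleton_iff.1 hw ▸ hf
        have := (analyticOnNhd_iteratedDeriv hk k z rfl).differentiableAt.hasDerivAt
        rw [← iteratedDeriv_succ] at this
        simpa [jet] using this
    have := hp.mul hX
    simp only [map_mul, Derivation.leibniz, smul_eq_mul, map_add]
    convert! this using 1
    ring

theorem eval_jet_iterate_totalDeriv_eq_zero {f : 𝕂 → 𝕂} {U : Set 𝕂} (hU : IsOpen U)
    (hf : AnalyticOnNhd 𝕂 f U) {Q : MvPolynomial ℕ 𝕂}
    (hQ : ∀ z ∈ U, MvPolynomial.eval (jet f z) Q = 0) (k : ℕ) :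
    ∀ z ∈ U, MvPolynomial.eval (jet f z) ((totalDeriv 𝕂)^[k] Q) = 0 := by
  induction k with
  | zero => exact hQ
  | succ k ih =>
    intro z hz
    rw [Function.iterate_succ_apply']
    refine (hasDerivAt_eval_jet (hf z hz) _).unique ?_
    refine (hasDerivAt_const z (0 : 𝕂)).congr_of_eventuallyEq ?_
    filter_upwards [hU.mem_nhds hz] with w hw using ih w hw

theorem isOpen_slice {α β : Type*} [TopologicalSpace α] [TopologicalSpace β] {Ω : Set (α × β)}
    (hΩ : IsOpen Ω) (u : α) : IsOpen (slice Ω u) :=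
  hΩ.preimage (Continuous.prodMk_right u)

theorem isOpen_base {α β : Type*} [TopologicalSpace α] [TopologicalSpace β] {Ω : Set (α × β)}
    (hΩ : IsOpen Ω) : IsOpen (base Ω) := by
  have : base Ω = Prod.fst '' Ω := by
    ext u
    exact ⟨fun ⟨v, hv⟩ => ⟨(u, v), hv, rfl⟩, fun ⟨⟨_, v⟩, hv, h⟩ => h ▸ ⟨v, hv⟩⟩
  exact this ▸ isOpenMap_fst Ω hΩ

variable {V : Type*} [NormedAddCommGroup V] [NormedSpace ℝ V]

/-- The derivatives of `F` in its second variable are jointly real analytic. -/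
theorem analyticOnNhd_iteratedDeriv_snd {Ω : Set (V × 𝕂)} (hΩ : IsOpen Ω) {F : V × 𝕂 → 𝕂}
    (hF : AnalyticOnNhd ℝ F Ω)
    (hFs : ∀ u, AnalyticOnNhd 𝕂 (fun v => F (u, v)) (slice Ω u)) (k : ℕ) :
    AnalyticOnNhd ℝ (fun q : V × 𝕂 => iteratedDeriv k (fun v => F (q.1, v)) q.2) Ω := by
  induction k with
  | zero => simpa using hF
  | succ k ih =>
    -- The `𝕂`-derivative in `v` is the real Fréchet derivative in the direction `(0, 1)`.
    have h1 := (ContinuousLinearMap.apply ℝ 𝕂 ((0, 1) : V × 𝕂)).comp_analyticOnNhd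
      (ih.fderiv_of_isOpen hΩ)
    refine h1.congr hΩ fun q hq => ?_
    have hd := ((analyticOnNhd_iteratedDeriv (hFs q.1) k) q.2 hq).differentiableAt.hasDerivAt
    rw [← iteratedDeriv_succ] at hd
    have h2 := (ih q hq).differentiableAt.hasFDerivAt
    have hpath : HasFDerivAt (fun v : 𝕂 => (q.1, v)) (ContinuousLinearMap.inr ℝ V 𝕂) q.2 :=
      hasFDerivAt_prodMk_right q.1 q.2
    have h3 := HasFDerivAt.comp q.2 (f := fun v : 𝕂 => (q.1, v)) h2 hpath
    have h4 := hd.hasFDerivAt.restrictScalars ℝ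
    have := DFunLike.congr_fun (h3.unique h4) 1
    simpa using this

theorem analyticOnNhd_eval_jet {Ω : Set (V × 𝕂)} (hΩ : IsOpen Ω) {F : V × 𝕂 → 𝕂}
    (hF : AnalyticOnNhd ℝ F Ω)
    (hFs : ∀ u, AnalyticOnNhd 𝕂 (fun v => F (u, v)) (slice Ω u)) (P : MvPolynomial ℕ 𝕂) :
    AnalyticOnNhd ℝ
      (fun q : V × 𝕂 => MvPolynomial.eval (jet (fun v => F (q.1, v)) q.2) P) Ω := by
  induction P using MvPolynomial.induction_on with
  | C a => simpa using analyticOnNhd_const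
  | add p q hp hq => simpa using! hp.add hq
  | mul_X p i hp =>
    have hX : AnalyticOnNhd ℝ (fun q : V × 𝕂 => jet (fun v => F (q.1, v)) q.2 i) Ω := by
      cases i with
      | zero => exact fun q _ => analyticAt_snd
      | succ k => exact analyticOnNhd_iteratedDeriv_snd hΩ hF hFs k
    simpa using! hp.mul hX

end Jets

end DiffAlg

namespace DiffAlg

/-! ### Smallness of zero sets of real analytic functions -/

section ZeroSets

open MeasureTheory Topology

/-- The zeros are isolated, since an accumulation point would force `h` to vanish on all of `s`. -/
theorem measure_zero_set_real {E : Type*} [NormedAddCommGroup E] [NormedSpace ℝ E] {h : ℝ → E}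
    {s : Set ℝ} (hh : AnalyticOnNhd ℝ h s) (hs : IsPreconnected s) {t₀ : ℝ} (ht₀ : t₀ ∈ s)
    (hne : h t₀ ≠ 0) : volume {t ∈ s | h t = 0} = 0 := by
  refine measure_null_of_locally_null _ fun t ht => ⟨{t}, ?_, measure_singleton t⟩
  have : ∀ᶠ z in 𝓝[≠] t, h z ≠ 0 := by
    rcases (hh t ht.1).eventually_eq_zero_or_eventually_ne_zero with h0 | h0
    · exact absurd (hh.eqOn_zero_of_preconnected_of_eventuallyEq_zero hs ht.1 h0 ht₀) hne
    · exact h0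
  rw [eventually_nhdsWithin_iff] at this
  rw [mem_nhdsWithin_iff_eventually]
  filter_upwards [this] with z hz hzs
  by_contra hzt
  exact hz hzt hzs.2

/-- The zero set of a real analytic function that does not vanish identically on a convex open
set is Lebesgue null. -/
theorem measure_zero_set_of_analyticOnNhd {V E : Type*} [NormedAddCommGroup V] [NormedSpace ℝ V]
    [FiniteDimensional ℝ V] [MeasurableSpace V] [BorelSpace V] (μ : Measure V)
    [μ.IsAddHaarMeasure] [NormedAddCommGroup E] [NormedSpace ℝ E] {g : V → E} {B : Set V}
    (hB : IsOpen B) (hconv : Convex ℝ B) (hg : AnalyticOnNhd ℝ g B) {x₀ : V} (hx₀ : x₀ ∈ B)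
    (hne : g x₀ ≠ 0) : μ {x ∈ B | g x = 0} = 0 := by
  have : ProperSpace V := FiniteDimensional.proper_real V
  let Z : Set V := {y | x₀ + y ∈ B ∧ g (x₀ + y) = 0}
  have hZ : MeasurableSet Z := by
    have hopen : IsOpen (B ∩ g ⁻¹' {0}ᶜ) :=
      hg.continuousOn.isOpen_inter_preimage hB isClosed_singleton.isOpen_compl
    have : Z = (fun y => x₀ + y) ⁻¹' (B \ (B ∩ g ⁻¹' {0}ᶜ)) := by
      ext y
      simp only [Z, Set.mem_ofPred_eq, Set.mem_preimage, Set.mem_sdiff, Set.mem_inter_iff,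
        Set.mem_compl_iff, Set.mem_singleton_iff]
      tauto
    rw [this]
    exact (measurable_const_add x₀) (hB.measurableSet.diff hopen.measurableSet)
  -- Every line through `x₀` meets the zero set in a null set. By Fubini, almost every dilate of `Z`
  -- is null, and one nonzero scale suffices.
  have hline : ∀ y : V, volume {t : ℝ | t • y ∈ Z} = 0 := fun y => by
    have hlin : AnalyticOnNhd ℝ (fun t : ℝ => x₀ + t • y) Set.univ := fun t _ =>
      analyticAt_const.add (analyticAt_id.smul analyticAt_const)
    have hcv : Convex ℝ ((fun t : ℝ => x₀ + t • y) ⁻¹' B) := by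
      have := hconv.affine_preimage (AffineMap.lineMap x₀ (x₀ + y) : ℝ →ᵃ[ℝ] V)
      have e : (fun t : ℝ => x₀ + t • y) = AffineMap.lineMap (k := ℝ) x₀ (x₀ + y) := by
        ext t
        simp [AffineMap.lineMap_apply, add_comm]
      rwa [e]
    have := measure_zero_set_real (h := fun t : ℝ => g (x₀ + t • y))
      (s := (fun t : ℝ => x₀ + t • y) ⁻¹' B) (t₀ := 0)
      (fun t ht => AnalyticAt.fun_comp (f := fun t : ℝ => x₀ + t • y) (hg _ ht) (hlin t trivial)) hcv.isPreconnected
      (by simpa using hx₀) (by simpa using hne)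
    exact this
  have hmeas : MeasurableSet {q : V × ℝ | q.2 • q.1 ∈ Z} :=
    (measurable_snd.smul measurable_fst) hZ
  have hprod : (μ.prod volume) {q : V × ℝ | q.2 • q.1 ∈ Z} = 0 := by
    rw [Measure.measure_prod_null hmeas]
    exact Filter.Eventually.of_forall hline
  have hprod' : (volume.prod μ) {q : ℝ × V | q.1 • q.2 ∈ Z} = 0 := by
    have hmeas' : MeasurableSet {q : ℝ × V | q.1 • q.2 ∈ Z} :=
      (measurable_fst.smul measurable_snd) hZ
    rw [← Measure.prod_swap, Measure.map_apply measurable_swap hmeas']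
    exact hprod
  have hae := Measure.measure_ae_null_of_prod_null hprod'
  obtain ⟨t, ht, ht0⟩ : ∃ t : ℝ, μ ((t • ·) ⁻¹' Z) = 0 ∧ t ≠ 0 := by
    have h0 : ∀ᵐ t : ℝ, t ≠ 0 := by simp [ae_iff]
    exact (hae.and h0).exists
  rw [Measure.addHaar_preimage_smul μ ht0, mul_eq_zero, ENNReal.ofReal_eq_zero] at ht
  have hpos : ¬ |(t ^ Module.finrank ℝ V)⁻¹| ≤ 0 := by
    rw [not_le, abs_pos]
    exact inv_ne_zero (pow_ne_zero _ ht0)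
  have hZ0 : μ Z = 0 := ht.resolve_left hpos
  rwa [show Z = (fun y => x₀ + y) ⁻¹' {x ∈ B | g x = 0} from rfl, measure_preimage_add] at hZ0

/-- The zero set of a real analytic function that does not vanish identically on a convex open
set is of first category. -/
theorem isMeagre_zero_set_of_analyticOnNhd {V E : Type*} [NormedAddCommGroup V] [NormedSpace ℝ V]
    [NormedAddCommGroup E] [NormedSpace ℝ E] {g : V → E} {B : Set V}
    (hB : IsOpen B) (hconv : Convex ℝ B) (hg : AnalyticOnNhd ℝ g B) {x₀ : V} (hx₀ : x₀ ∈ B)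
    (hne : g x₀ ≠ 0) : IsMeagre {x ∈ B | g x = 0} := by
  refine IsNowhereDense.isMeagre
    (isNowhereDense_iff_forall_notMem_nhds.2 fun x hx hcl => hne ?_)
  refine hg.eqOn_zero_of_preconnected_of_eventuallyEq_zero hconv.isPreconnected hx.1 ?_ hx₀
  filter_upwards [hcl, hB.mem_nhds hx.1] with y hy hyB
  by_contra hgy
  have hopen : IsOpen (B ∩ g ⁻¹' {0}ᶜ) :=
    hg.continuousOn.isOpen_inter_preimage hB isClosed_singleton.isOpen_compl
  obtain ⟨z, hz, hz'⟩ := mem_closure_iff.1 hy _ hopen ⟨hyB, hgy⟩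
  exact hz.2 hz'.2

end ZeroSets

end DiffAlg

namespace DiffAlg

/-! ### The countable family of equations and exceptional parameters -/

section Alternative

open MeasureTheory Topology

/-- The differential equations of differentially algebraic functions can be taken from a countable
family. -/
theorem exists_universal_family (𝕂 : Type*) [RCLike 𝕂] :
    ∃ P : Finset (ℕ →₀ ℕ) → MvPolynomial ℕ 𝕂, (∀ S, P S ≠ 0) ∧
      ∀ (f : 𝕂 → 𝕂) (U : Set 𝕂), IsOpen U → IsDA f U →
        ∃ S, ∀ z ∈ U, MvPolynomial.eval (jet f z) (P S) = 0 := by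
  choose P hP hPφ using exists_universal_polynomial (K := 𝕂)
  refine ⟨P, hP, fun f U hU ⟨hf, n, Q, hQ, hQf⟩ => ?_⟩
  rw [satisfiesADE_iff] at hQf
  refine ⟨(MvPolynomial.rename Fin.val Q).support, fun z hz => ?_⟩
  have h := hPφ _ (MvPolynomial.aeval (jet f z)) (MvPolynomial.rename Fin.val Q)
    (fun h => hQ (MvPolynomial.rename_injective _ Fin.val_injective (h.trans (map_zero _).symm)))
    subset_rfl
  simp only [MvPolynomial.aeval_eq_eval] at h
  exact h fun k => eval_jet_iterate_totalDeriv_eq_zero hU hf hQf k z hz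

theorem null_and_isMeagre_of_locally {X : Type*} [TopologicalSpace X] [SecondCountableTopology X]
    [MeasurableSpace X] (μ : Measure X) {s : Set X}
    (h : ∀ x ∈ s, ∃ t ∈ 𝓝[s] x, μ t = 0 ∧ IsMeagre t) : μ s = 0 ∧ IsMeagre s := by
  choose! t ht hμ hm using h
  obtain ⟨c, hcs, hc, hsub⟩ := TopologicalSpace.countable_cover_nhdsWithin ht
  exact ⟨measure_mono_null hsub ((measure_biUnion_null_iff hc).2 fun x hx => hμ x (hcs hx)),
    (isMeagre_biUnion hc fun x hx => hm x (hcs hx)).mono hsub⟩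

/-- If an analytic function does not vanish identically on a connected open set `Ω`, then it
vanishes identically on the slice `Ω(u)` only for a null and meagre set of parameters `u`. -/
theorem null_and_isMeagre_vanishing_slices {V W E : Type*} [NormedAddCommGroup V]
    [NormedSpace ℝ V] [FiniteDimensional ℝ V] [MeasurableSpace V] [BorelSpace V] (μ : Measure V)
    [μ.IsAddHaarMeasure] [NormedAddCommGroup W] [NormedSpace ℝ W] [NormedAddCommGroup E]
    [NormedSpace ℝ E] {Ω : Set (V × W)} (hΩ : IsOpen Ω) (hconn : IsPreconnected Ω)
    {G : V × W → E} (hG : AnalyticOnNhd ℝ G Ω) (hne : ∃ q ∈ Ω, G q ≠ 0) :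
    μ {u ∈ base Ω | ∀ v ∈ slice Ω u, G (u, v) = 0} = 0 ∧
      IsMeagre {u ∈ base Ω | ∀ v ∈ slice Ω u, G (u, v) = 0} := by
  have : ProperSpace V := FiniteDimensional.proper_real V
  refine null_and_isMeagre_of_locally μ fun u hu => ?_
  obtain ⟨v, hv⟩ := hu.1
  obtain ⟨r, hr, hball⟩ := Metric.isOpen_iff.1 hΩ (u, v) hv
  rw [← ball_prod_same] at hball
  -- By the identity theorem `G` is nonzero somewhere in the box. With `v₁` frozen, nearby bad
  -- parameters are zeros of `G (·, v₁)`, which is not identically zero.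
  obtain ⟨⟨u₁, v₁⟩, ⟨hu₁, hv₁⟩, hne₁⟩ :
      ∃ q ∈ Metric.ball u r ×ˢ Metric.ball v r, G q ≠ 0 := by
    by_contra! h
    obtain ⟨q, hq, hGq⟩ := hne
    refine hGq (hG.eqOn_zero_of_preconnected_of_eventuallyEq_zero hconn hv ?_ hq)
    filter_upwards [prod_mem_nhds (Metric.ball_mem_nhds u hr) (Metric.ball_mem_nhds v hr)]
      with q hq using h q hq
  have hg : AnalyticOnNhd ℝ (fun x => G (x, v₁)) (Metric.ball u r) := fun x hx =>
    AnalyticAt.fun_comp (f := fun x : V => (x, v₁)) (hG _ (hball ⟨hx, hv₁⟩))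
      (analyticAt_id.prod analyticAt_const)
  refine ⟨{x ∈ Metric.ball u r | G (x, v₁) = 0}, ?_,
    measure_zero_set_of_analyticOnNhd μ Metric.isOpen_ball (convex_ball u r) hg hu₁ hne₁,
    isMeagre_zero_set_of_analyticOnNhd Metric.isOpen_ball (convex_ball u r) hg hu₁ hne₁⟩
  rw [mem_nhdsWithin_iff_eventually]
  filter_upwards [Metric.ball_mem_nhds u hr] with x hx hxs
  exact ⟨hx, hxs.2 v₁ (hball ⟨hx, hv₁⟩)⟩

end Alternative

end DiffAlg

theorem mainTheorem4 {𝕂 : Type*} [RCLike 𝕂] (p : ℕ)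
    (Ω : Set (EuclideanSpace ℝ (Fin p) × 𝕂)) (hΩ_open : IsOpen Ω) (hΩ_conn : IsConnected Ω)
    (F : EuclideanSpace ℝ (Fin p) × 𝕂 → 𝕂)
    (hF : AnalyticOnNhd ℝ F Ω)
    (hF_slice : ∀ u : EuclideanSpace ℝ (Fin p),
      AnalyticOnNhd 𝕂 (fun v : 𝕂 => F (u, v)) (DiffAlg.slice Ω u)) :
    Xor
      ((∀ u ∈ DiffAlg.base Ω, DiffAlg.IsDA (fun v : 𝕂 => F (u, v)) (DiffAlg.slice Ω u)) ∧
        ∃ (n : ℕ) (Q : MvPolynomial (Fin (n + 2)) 𝕂), Q ≠ 0 ∧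
          ∀ u ∈ DiffAlg.base Ω,
            DiffAlg.SatisfiesADE Q (fun v : 𝕂 => F (u, v)) (DiffAlg.slice Ω u))
      (DiffAlg.IsGenericIn
        {u ∈ DiffAlg.base Ω | ¬ DiffAlg.IsDA (fun v : 𝕂 => F (u, v)) (DiffAlg.slice Ω u)}
        (DiffAlg.base Ω)) := by
  have hexcl : (∀ u ∈ DiffAlg.base Ω,
      DiffAlg.IsDA (fun v : 𝕂 => F (u, v)) (DiffAlg.slice Ω u)) →
      ¬ DiffAlg.IsGenericIn
        {u ∈ DiffAlg.base Ω | ¬ DiffAlg.IsDA (fun v : 𝕂 => F (u, v)) (DiffAlg.slice Ω u)}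
        (DiffAlg.base Ω) := by
    -- The alternatives exclude each other because the base is open and nonempty, hence not null.
    rintro hDA ⟨-, hnull, -⟩
    rw [show {u ∈ DiffAlg.base Ω |
        ¬ DiffAlg.IsDA (fun v : 𝕂 => F (u, v)) (DiffAlg.slice Ω u)} = ∅ from
      Set.eq_empty_of_forall_notMem fun u hu => hu.2 (hDA u hu.1), Set.sdiff_empty] at hnull
    obtain ⟨⟨u, v⟩, huv⟩ := hΩ_conn.nonempty
    exact ((DiffAlg.isOpen_base hΩ_open).measure_pos MeasureTheory.volume ⟨u, v, huv⟩).ne' hnull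
  obtain ⟨P, hP, hPDA⟩ := DiffAlg.exists_universal_family 𝕂
  by_cases h : ∃ S, ∀ q ∈ Ω, MvPolynomial.eval (DiffAlg.jet (fun v => F (q.1, v)) q.2) (P S) = 0
  · obtain ⟨S, hS⟩ := h
    obtain ⟨n, Q, hQ⟩ := DiffAlg.exists_rename_fin_val (P S)
    have hQ0 : Q ≠ 0 := fun h0 => hP S (by rw [← hQ, h0, map_zero])
    have hsat : ∀ u, DiffAlg.SatisfiesADE Q (fun v : 𝕂 => F (u, v)) (DiffAlg.slice Ω u) :=
      fun u => (DiffAlg.satisfiesADE_iff Q _ _).2 fun v hv => hQ ▸ hS (u, v) hv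
    have hDA : ∀ u ∈ DiffAlg.base Ω,
        DiffAlg.IsDA (fun v : 𝕂 => F (u, v)) (DiffAlg.slice Ω u) :=
      fun u _ => ⟨hF_slice u, n, Q, hQ0, hsat u⟩
    exact Or.inl ⟨⟨hDA, n, Q, hQ0, fun u _ => hsat u⟩, hexcl hDA⟩
  · push Not at h
    have hnull := fun S => DiffAlg.null_and_isMeagre_vanishing_slices MeasureTheory.volume
      hΩ_open hΩ_conn.isPreconnected
      (DiffAlg.analyticOnNhd_eval_jet hΩ_open hF hF_slice (P S)) (h S)
    have hsub : DiffAlg.base Ω \ {u ∈ DiffAlg.base Ω |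
        ¬ DiffAlg.IsDA (fun v : 𝕂 => F (u, v)) (DiffAlg.slice Ω u)} ⊆
        ⋃ S, {u ∈ DiffAlg.base Ω | ∀ v ∈ DiffAlg.slice Ω u,
          MvPolynomial.eval (DiffAlg.jet (fun v => F (u, v)) v) (P S) = 0} := by
      rintro u ⟨hu, hu'⟩
      have hDA : DiffAlg.IsDA (fun v : 𝕂 => F (u, v)) (DiffAlg.slice Ω u) := by
        by_contra hDA
        exact hu' ⟨hu, hDA⟩
      obtain ⟨S, hS⟩ := hPDA _ _ (DiffAlg.isOpen_slice hΩ_open u) hDA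
      exact Set.mem_iUnion.2 ⟨S, hu, hS⟩
    have hgen : DiffAlg.IsGenericIn {u ∈ DiffAlg.base Ω |
        ¬ DiffAlg.IsDA (fun v : 𝕂 => F (u, v)) (DiffAlg.slice Ω u)} (DiffAlg.base Ω) :=
      ⟨Set.sep_subset _ _,
      MeasureTheory.measure_mono_null hsub
        (MeasureTheory.measure_iUnion_null fun S => (hnull S).1),
      (isMeagre_iUnion fun S => (hnull S).2).mono hsub⟩
    exact Or.inr ⟨hgen, fun hI => hexcl hI.1 hgen⟩
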